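/- All graphs are finite, simple, and regular of positive degree. For such a graph $G$ on the vertex set $[n]$, write $G$ also for its (symmetric, stochastic) random walk matrix, $G_{ij}=1/\deg(i)$ if $ij$ is an edge and $G_{ij}=0$ otherwise. For a nonempty $S\subseteq[n]$ let $\Phi_G(S)=1-\frac{1}{|S|}\langle 1_S,G1_S\rangle$ be its expansion. For $\varepsilon\ge 0$ and $\delta\in(0,1/2]$, we say that $G$ is an almost $(\varepsilon,\delta)$ small-set expander with non-expanding set $S\subseteq[n]$ if - $|S|=\delta n$ and $\Phi_G(S)\le\varepsilon$, and - every $T\subseteq[n]$ with $|T|=\delta n$ and $T\cap S=\emptyset$ satisfies $\Phi_G(T)\ge 1-\varepsilon$. Let $\Pi_{1/2}\in\mathbb{R}^{n\times n}$ be the orthogonal projector onto the span of the eigenvectors of $G$ with eigenvalue at least $1/2$. An isotropic spectral embedding of $G$ is a sequence $b_1,\dots,b_n$ with $b_i=\sqrt n\,a_i$, where $a_1,\dots,a_n$ are the rows of a real matrix $A$ with $AA^\top=\Pi_{1/2}$ (for instance one whose first column is $\mathbf 1/\sqrt n$). **Lemma.** There is a universal constant $\varepsilon_0>0$ such that the following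 holds. Let $0\le\varepsilon<\varepsilon_0$ and $0<\delta\le 1/2$, let $G$ be an $n$-node almost $(\varepsilon,\delta)$ small-set expander with non-expanding set $S$, and let $b_1,\dots,b_n$ be an isotropic spectral embedding of $G$. Then every nonempty $T\subseteq[n]$ with $|T|\le\delta n$ and $T\cap S=\emptyset$ satisfies $$\Big\|\frac{1}{|T|}\sum_{i\in T}b_i\Big\|\cdot\frac{|T|}{n}\;\le\;2\,\varepsilon^{0.05}\sqrt{\delta}.$$ -/

import Mathlib

open scoped Matrix

noncomputable section

namespace SmallSetExpansion

/-- The random walk matrix of a graph: from `i`, move to a uniformly random neighbour of `i`. -/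
def walkMatrix {n : ℕ} (G : SimpleGraph (Fin n)) [DecidableRel G.Adj] :
    Matrix (Fin n) (Fin n) ℝ :=
  Matrix.of fun i j => if G.Adj i j then ((G.degree i : ℝ))⁻¹ else 0

/-- The `0/1` indicator vector of a set of vertices. -/
def indicatorVec {n : ℕ} (S : Finset (Fin n)) : Fin n → ℝ :=
  fun i => if i ∈ S then 1 else 0

/-- The expansion `Φ_G(S) = 1 - ⟨1_S, G 1_S⟩ / |S|`. -/
def expansion {n : ℕ} (G : SimpleGraph (Fin n)) [DecidableRel G.Adj] (S : Finset (Fin n)) : ℝ :=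
  1 - (S.card : ℝ)⁻¹ * (indicatorVec S ⬝ᵥ (walkMatrix G *ᵥ indicatorVec S))

/-- `G` is an almost `(ε, δ)` small-set expander, with non-expanding set `S`. -/
structure IsAlmostSSEWith {n : ℕ} (G : SimpleGraph (Fin n)) [DecidableRel G.Adj] (ε δ : ℝ)
    (S : Finset (Fin n)) : Prop where
  card_eq : (S.card : ℝ) = δ * n
  nonexpanding : expansion G S ≤ ε
  expanding : ∀ T : Finset (Fin n), (T.card : ℝ) = δ * n → Disjoint T S → 1 - ε ≤ expansion G T

/-- The span of the eigenvectors of the random walk matrix with eigenvalue at least `1/2`. -/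
def topEigenspace {n : ℕ} (G : SimpleGraph (Fin n)) [DecidableRel G.Adj] :
    Submodule ℝ (EuclideanSpace ℝ (Fin n)) :=
  ⨆ μ : ℝ, ⨆ _ : 1 / 2 ≤ μ,
    Module.End.eigenspace (Matrix.toEuclideanLin (walkMatrix G)) μ

/-- The matrix `Π_{1/2}` of the orthogonal projector onto `topEigenspace G`. -/
def topProjector {n : ℕ} (G : SimpleGraph (Fin n)) [DecidableRel G.Adj] :
    Matrix (Fin n) (Fin n) ℝ :=
  Matrix.toEuclideanLin.symm ((topEigenspace G).starProjection : _ →ₗ[ℝ] _)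

/-- `b₁, …, bₙ` is an isotropic spectral embedding of `G`: `bᵢ = √n aᵢ`, where the `aᵢ` are the
rows of a matrix `A` with `A Aᵀ = Π_{1/2}`. Every such `A` is allowed; the customary choice, whose
first column is `1/√n`, is one of them. -/
def IsIsotropicSpectralEmbedding {n m : ℕ} (G : SimpleGraph (Fin n)) [DecidableRel G.Adj]
    (b : Fin n → EuclideanSpace ℝ (Fin m)) : Prop :=
  ∃ A : Matrix (Fin n) (Fin m) ℝ, A * Aᵀ = topProjector G ∧
    ∀ i, b i = Real.sqrt n • WithLp.toLp 2 (A i)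

end SmallSetExpansion

end

open Finset

namespace SmallSetExpansion

section Weights

variable {V : Type*} [Fintype V] [DecidableEq V] {W : V → V → ℝ} {S : Finset V} {ε : ℝ}

/-! Isotropy turns the squared norm of the sum of `b i` over `T` into `n * ‖Π 1_T‖ ^ 2`
(`norm_sum_sq`). The walk operator has an inverse of norm at most 2 on the range of `Π`, so `‖Π 1_T‖
≤ 2 * ‖G 1_T‖` (`mul_norm_starProjection_le`). It remains to see that `G 1_T` is spread out
(`sum_sq_walk_le`): little of its mass lies in `S`, which hardly leaks, and few vertices outside `S`
can have a large value, since with `T` they would form a small set with too much internal weight.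
That argument needs room beside `T`, so `T` is first cut in two halves. -/

/-! ### Combinatorial estimates for doubly stochastic weights. -/

/-- A small set which avoids `S` carries little internal weight, whatever its size. -/
lemma sum_sum_le_of_disjoint (hW : ∀ i j, 0 ≤ W i j)
    (hcard : 2 * S.card ≤ Fintype.card V)
    (hexp : ∀ R : Finset V, R.card = S.card → Disjoint R S →
      ∑ i ∈ R, ∑ j ∈ R, W i j ≤ ε * S.card)
    {T U : Finset V} (hT : Disjoint T S) (hU : Disjoint U S)
    (hTU : T.card + U.card ≤ S.card) :
    ∑ i ∈ U, ∑ j ∈ T, W i j ≤ ε * S.card := by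
  have hsub : T ∪ U ⊆ Sᶜ := by
    rw [subset_compl_iff_disjoint_right]
    exact disjoint_union_left.2 ⟨hT, hU⟩
  -- `hexp` sees only sets of size exactly `S.card`; `hcard` leaves room to pad `T ∪ U` outside `S`.
  obtain ⟨R, hR, hRS, hRc⟩ := exists_subsuperset_card_eq hsub
    ((card_union_le T U).trans hTU) (by rw [card_compl]; omega)
  refine le_trans ?_ (hexp R hRc (subset_compl_iff_disjoint_right.1 hRS))
  calc ∑ i ∈ U, ∑ j ∈ T, W i j ≤ ∑ i ∈ U, ∑ j ∈ R, W i j :=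
        sum_le_sum fun i _ => sum_le_sum_of_subset_of_nonneg
          (subset_union_left.trans hR) fun j _ _ => hW i j
    _ ≤ ∑ i ∈ R, ∑ j ∈ R, W i j :=
        sum_le_sum_of_subset_of_nonneg (subset_union_right.trans hR)
          fun i _ _ => sum_nonneg fun j _ => hW i j

/-- Rows have total weight one, so what stays inside `S` is unavailable to `T`. -/
lemma sum_sum_le_of_nonexpanding (hW : ∀ i j, 0 ≤ W i j) (hrow : ∀ i, ∑ j, W i j = 1)
    (hS : (1 - ε) * S.card ≤ ∑ i ∈ S, ∑ j ∈ S, W i j)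
    {T : Finset V} (hT : Disjoint T S) :
    ∑ i ∈ S, ∑ j ∈ T, W i j ≤ ε * S.card := by
  have h1 : ∑ i ∈ S, ∑ j ∈ S, W i j + ∑ i ∈ S, ∑ j ∈ T, W i j ≤ S.card := by
    rw [← sum_add_distrib, card_eq_sum_ones, Nat.cast_sum]
    refine sum_le_sum fun i _ => ?_
    rw [← sum_union hT.symm, Nat.cast_one, ← hrow i]
    exact sum_le_sum_of_subset_of_nonneg (subset_univ _) fun j _ _ => hW i j
  linarith

/-- One step of the walk spreads out the indicator of a small set that avoids `S`. -/
lemma sum_sq_walk_le (hε : 0 ≤ ε) (hW : ∀ i j, 0 ≤ W i j)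
    (hrow : ∀ i, ∑ j, W i j = 1) (hcol : ∀ j, ∑ i, W i j = 1)
    (hcard : 2 * S.card ≤ Fintype.card V)
    (hS : (1 - ε) * S.card ≤ ∑ i ∈ S, ∑ j ∈ S, W i j)
    (hexp : ∀ R : Finset V, R.card = S.card → Disjoint R S →
      ∑ i ∈ R, ∑ j ∈ R, W i j ≤ ε * S.card)
    (htwo : 2 ≤ S.card)
    {T : Finset V} (hT : Disjoint T S) (hTc : T.card + S.card / 2 ≤ S.card) :
    ∑ i, (∑ j ∈ T, W i j) ^ 2 ≤ 6 * ε * S.card := by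
  set f : V → ℝ := fun i => ∑ j ∈ T, W i j with hf
  have hf0 : ∀ i, 0 ≤ f i := fun i => sum_nonneg fun j _ => hW i j
  have hf1 : ∀ i, f i ≤ 1 := fun i => by
    rw [← hrow i]
    exact sum_le_sum_of_subset_of_nonneg (subset_univ _) fun j _ _ => hW i j
  have hsq : ∀ i, f i ^ 2 ≤ f i := fun i => by nlinarith [hf0 i, hf1 i]
  have hs : (0 : ℝ) < S.card := by exact_mod_cast (by omega : 0 < S.card)
  have htot : ∑ i, f i ≤ S.card := by
    simp only [hf]
    rw [sum_comm]
    simp only [hcol, sum_const, nsmul_eq_mul, mul_one]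
    exact_mod_cast (by omega : T.card ≤ S.card)
  set U : Finset V := {i ∈ Sᶜ | 4 * ε < f i} with hU
  have hUS : Disjoint U S := subset_compl_iff_disjoint_right.1 (filter_subset _ _)
  have hUc : U.card ≤ S.card / 2 := by
    by_contra! h
    obtain ⟨U', hU', hU'c⟩ := exists_subset_card_eq h.le
    have h1 := sum_sum_le_of_disjoint hW hcard hexp hT (hUS.mono_left hU')
      (by omega)
    have h2 : (U'.card : ℝ) * (4 * ε) < ∑ i ∈ U', f i := by
      rw [← nsmul_eq_mul, ← sum_const]
      refine sum_lt_sum_of_nonempty (card_pos.1 (by omega)) fun i hi => ?_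
      exact (mem_filter.1 (hU' hi)).2
    -- Rounding down loses most at `S.card = 3`, hence the factor 3; the threshold `4 * ε` beats it.
    have h3 : (S.card : ℝ) ≤ 3 * U'.card := by
      exact_mod_cast (by omega : S.card ≤ 3 * U'.card)
    have h4 : (0 : ℝ) ≤ U'.card := Nat.cast_nonneg _
    nlinarith
  have hUle : ∑ i ∈ U, f i ≤ ε * S.card :=
    sum_sum_le_of_disjoint hW hcard hexp hT hUS (by omega)
  have hSle : ∑ i ∈ S, f i ≤ ε * S.card := sum_sum_le_of_nonexpanding hW hrow hS hT
  have hrest : ∑ i ∈ Sᶜ with ¬ 4 * ε < f i, f i ^ 2 ≤ 4 * ε * S.card := by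
    calc ∑ i ∈ Sᶜ with ¬ 4 * ε < f i, f i ^ 2
        ≤ ∑ i ∈ Sᶜ with ¬ 4 * ε < f i, 4 * ε * f i := by
          refine sum_le_sum fun i hi => ?_
          have := not_lt.1 (mem_filter.1 hi).2
          nlinarith [hf0 i]
      _ ≤ ∑ i, 4 * ε * f i :=
          sum_le_sum_of_subset_of_nonneg (subset_univ _) fun i _ _ =>
            mul_nonneg (by linarith) (hf0 i)
      _ ≤ 4 * ε * S.card := by
          rw [← mul_sum]
          exact mul_le_mul_of_nonneg_left htot (by linarith)
  rw [← sum_add_sum_compl S, ← sum_filter_add_sum_filter_not Sᶜ (fun i => 4 * ε < f i)]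
  have h1 := (sum_le_sum fun i (_ : i ∈ S) => hsq i).trans hSle
  have h2 := (sum_le_sum fun i (_ : i ∈ U) => hsq i).trans hUle
  linarith

end Weights

section Spectral

/-! ### Spectral bound for symmetric operators. -/

variable {E : Type*} [NormedAddCommGroup E] [InnerProductSpace ℝ E]

/-- On the span of the eigenspaces with eigenvalue at least `c > 0`, a symmetric operator has a
right inverse of norm at most `c⁻¹`. -/
lemma exists_apply_eq_of_mem_iSup_eigenspace {L : E →ₗ[ℝ] E} (hL : L.IsSymmetric) {c : ℝ}
    (hc : 0 < c) {y : E} (hy : y ∈ ⨆ μ : ℝ, ⨆ _ : c ≤ μ, Module.End.eigenspace L μ) :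
    ∃ w, L w = y ∧ c * ‖w‖ ≤ ‖y‖ := by
  classical
  rw [iSup_subtype', Submodule.mem_iSup_iff_exists_finsupp] at hy
  obtain ⟨g, hg, rfl⟩ := hy
  have hO := hL.orthogonalFamily_eigenspaces.comp
    (Subtype.val_injective (p := fun μ : ℝ => c ≤ μ))
  refine ⟨∑ μ ∈ g.support, (μ : ℝ)⁻¹ • g μ, ?_, ?_⟩
  · rw [map_sum, Finsupp.sum]
    refine sum_congr rfl fun μ _ => ?_
    rw [map_smul, Module.End.mem_eigenspace_iff.1 (hg μ), smul_smul,
      inv_mul_cancel₀ (hc.trans_le μ.2).ne', one_smul]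
  · refine le_of_sq_le_sq ?_ (norm_nonneg _)
    have h1 := hO.norm_sum (fun μ => ⟨g μ, hg μ⟩) g.support
    have h2 := hO.norm_sum (fun μ => (μ : ℝ)⁻¹ • ⟨g μ, hg μ⟩) g.support
    simp only [Submodule.coe_subtypeₗᵢ, Submodule.coe_subtype, Submodule.coe_norm,
      Submodule.coe_smul] at h1 h2
    rw [Finsupp.sum, h1, mul_pow, h2, mul_sum]
    refine sum_le_sum fun μ _ => ?_
    have hμ : 0 < (μ : ℝ) := hc.trans_le μ.2
    rw [norm_smul, Real.norm_eq_abs, abs_of_pos (inv_pos.2 hμ), mul_pow, ← mul_assoc, ← mul_pow]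
    refine mul_le_of_le_one_left (sq_nonneg _) (pow_le_one₀ (by positivity) ?_)
    rw [← div_eq_mul_inv, div_le_one hμ]
    exact μ.2

/-- With `P` the projection and `L w = P x`, symmetry gives `‖P x‖ ^ 2 = ⟪w, L x⟫`; apply
Cauchy–Schwarz and the bound on `w`. -/
lemma mul_norm_starProjection_le [FiniteDimensional ℝ E] {L : E →ₗ[ℝ] E} (hL : L.IsSymmetric) {c : ℝ} (hc : 0 < c)
    (x : E) :
    c * ‖(⨆ μ : ℝ, ⨆ _ : c ≤ μ, Module.End.eigenspace L μ).starProjection x‖ ≤ ‖L x‖ := by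
  set K : Submodule ℝ E := ⨆ μ : ℝ, ⨆ _ : c ≤ μ, Module.End.eigenspace L μ
  obtain ⟨w, hw, hwn⟩ := exists_apply_eq_of_mem_iSup_eigenspace hL hc
    (K.starProjection_apply_mem x)
  rcases (norm_nonneg (K.starProjection x)).eq_or_lt with h0 | h0
  · rw [← h0, mul_zero]
    exact norm_nonneg _
  have h1 : ‖K.starProjection x‖ ^ 2 = inner ℝ w (L x) := by
    rw [← hL, hw, ← real_inner_self_eq_norm_sq, K.inner_starProjection_left_eq_right,
      K.starProjection_eq_self_iff.2 (K.starProjection_apply_mem x),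
      ← K.inner_starProjection_left_eq_right]
  have h2 := real_inner_le_norm w (L x)
  have h3 := mul_le_mul_of_nonneg_right hwn (norm_nonneg (L x))
  refine le_of_mul_le_mul_left ?_ h0
  nlinarith

end Spectral

/-! ### Application to the random walk. -/

variable {n d : ℕ} {G : SimpleGraph (Fin n)} [DecidableRel G.Adj]

lemma walkMatrix_nonneg (i j : Fin n) : 0 ≤ walkMatrix G i j := by
  rw [walkMatrix, Matrix.of_apply]
  split_ifs <;> positivity

lemma walkMatrix_self (i : Fin n) : walkMatrix G i i = 0 := by
  simp [walkMatrix]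

lemma walkMatrix_comm (hG : G.IsRegularOfDegree d) (i j : Fin n) :
    walkMatrix G i j = walkMatrix G j i := by
  simp only [walkMatrix, Matrix.of_apply, hG i, hG j, G.adj_comm i j]

lemma sum_walkMatrix_row (hd : 0 < d) (hG : G.IsRegularOfDegree d) (i : Fin n) :
    ∑ j, walkMatrix G i j = 1 := by
  have hdeg : ({j | G.Adj i j} : Finset (Fin n)).card = d := by
    rw [← hG i, ← G.card_neighborFinset_eq_degree, G.neighborFinset_eq_filter]
  simp only [walkMatrix, Matrix.of_apply, ← sum_filter, sum_const, hdeg, hG i, nsmul_eq_mul]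
  exact mul_inv_cancel₀ (Nat.cast_ne_zero.2 hd.ne')

lemma sum_walkMatrix_col (hd : 0 < d) (hG : G.IsRegularOfDegree d) (j : Fin n) :
    ∑ i, walkMatrix G i j = 1 := by
  simp only [walkMatrix_comm hG _ j, sum_walkMatrix_row hd hG]

lemma mulVec_indicatorVec (M : Matrix (Fin n) (Fin n) ℝ) (T : Finset (Fin n)) (i : Fin n) :
    (M *ᵥ indicatorVec T) i = ∑ j ∈ T, M i j := by
  simp [Matrix.mulVec, dotProduct, indicatorVec]

lemma indicatorVec_dotProduct (T : Finset (Fin n)) (v : Fin n → ℝ) :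
    indicatorVec T ⬝ᵥ v = ∑ i ∈ T, v i := by
  simp [dotProduct, indicatorVec]

lemma expansion_mul_card (T : Finset (Fin n)) :
    expansion G T * T.card = T.card - ∑ i ∈ T, ∑ j ∈ T, walkMatrix G i j := by
  rcases T.eq_empty_or_nonempty with rfl | hT
  · simp
  have : (T.card : ℝ) ≠ 0 := Nat.cast_ne_zero.2 hT.card_pos.ne'
  simp only [expansion, indicatorVec_dotProduct, mulVec_indicatorVec]
  field_simp

lemma isSymmetric_toEuclideanLin_walkMatrix (hG : G.IsRegularOfDegree d) :
    (Matrix.toEuclideanLin (walkMatrix G)).IsSymmetric := by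
  rw [Matrix.isSymmetric_toEuclideanLin_iff]
  ext i j
  simpa using walkMatrix_comm hG j i

/-- The indicator of `T`, as a vector of the Euclidean space. -/
def euclideanIndicator (T : Finset (Fin n)) : EuclideanSpace ℝ (Fin n) :=
  WithLp.toLp 2 (indicatorVec T)

lemma euclideanIndicator_eq_add {R T : Finset (Fin n)} (h : R ⊆ T) :
    euclideanIndicator T = euclideanIndicator R + euclideanIndicator (T \ R) := by
  ext i
  by_cases hR : i ∈ R
  · simp [euclideanIndicator, indicatorVec, hR, h hR]
  · simp [euclideanIndicator, indicatorVec, hR]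

lemma norm_starProjection_euclideanIndicator_sq_le (hG : G.IsRegularOfDegree d)
    (T : Finset (Fin n)) :
    ‖(topEigenspace G).starProjection (euclideanIndicator T)‖ ^ 2 ≤
      4 * ∑ i, (∑ j ∈ T, walkMatrix G i j) ^ 2 := by
  have h := mul_norm_starProjection_le (isSymmetric_toEuclideanLin_walkMatrix hG)
    (by norm_num : (0 : ℝ) < 1 / 2) (euclideanIndicator T)
  have h2 : ‖Matrix.toEuclideanLin (walkMatrix G) (euclideanIndicator T)‖ ^ 2 =
      ∑ i, (∑ j ∈ T, walkMatrix G i j) ^ 2 := by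
    rw [EuclideanSpace.real_norm_sq_eq]
    refine sum_congr rfl fun i _ => ?_
    rw [euclideanIndicator, Matrix.toLpLin_toLp, Matrix.toLin'_apply, ← mulVec_indicatorVec]
  rw [← h2]
  have h3 := pow_le_pow_left₀ (by positivity) h 2
  rw [topEigenspace]
  linarith

/-- Both sides are `n * ⟪1_T, A Aᵀ 1_T⟫`, so the choice of `A` is immaterial. -/
lemma IsIsotropicSpectralEmbedding.norm_sum_sq {m : ℕ} {b : Fin n → EuclideanSpace ℝ (Fin m)}
    (hb : IsIsotropicSpectralEmbedding G b) (T : Finset (Fin n)) :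
    ‖∑ i ∈ T, b i‖ ^ 2 =
      n * ‖(topEigenspace G).starProjection (euclideanIndicator T)‖ ^ 2 := by
  obtain ⟨A, hA, hb⟩ := hb
  have h1 : ∑ i ∈ T, b i = Real.sqrt n • WithLp.toLp 2 (Aᵀ *ᵥ indicatorVec T) := by
    simp only [hb, ← smul_sum]
    congr 1
    ext k
    simp [Matrix.mulVec, dotProduct, indicatorVec]
    exact Finset.sum_apply k T A
  have h2 : Matrix.toEuclideanLin (topProjector G) (euclideanIndicator T) =
      (topEigenspace G).starProjection (euclideanIndicator T) := by
    simp [topProjector]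
  rw [h1, norm_smul, mul_pow, Real.norm_eq_abs, sq_abs, Real.sq_sqrt n.cast_nonneg]
  congr 1
  have h3 : ‖(topEigenspace G).starProjection (euclideanIndicator T)‖ ^ 2 =
      inner ℝ (euclideanIndicator T)
        ((topEigenspace G).starProjection (euclideanIndicator T)) := by
    rw [← real_inner_self_eq_norm_sq, Submodule.inner_starProjection_left_eq_right,
      Submodule.starProjection_eq_self_iff.2 (Submodule.starProjection_apply_mem _ _)]
  rw [h3, ← h2, ← hA, euclideanIndicator, Matrix.toLpLin_toLp, EuclideanSpace.inner_toLp_toLp,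
    EuclideanSpace.real_norm_sq_eq, Matrix.toLin'_apply, ← Matrix.mulVec_mulVec, star_trivial, dotProduct_comm,
    Matrix.dotProduct_mulVec, ← Matrix.mulVec_transpose]
  simp [dotProduct, sq]

lemma IsAlmostSSEWith.norm_starProjection_le {ε δ : ℝ} {S : Finset (Fin n)} (hd : 0 < d)
    (hG : G.IsRegularOfDegree d) (hε : 0 ≤ ε) (hε1 : ε < 1) (hδ : δ ≤ 1 / 2)
    (h : IsAlmostSSEWith G ε δ S) {T : Finset (Fin n)}
    (hTc : T.card ≤ S.card) (hT : Disjoint T S) :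
    ‖(topEigenspace G).starProjection (euclideanIndicator T)‖ ≤
      2 * Real.sqrt (24 * ε * S.card) := by
  have hcard : 2 * S.card ≤ Fintype.card (Fin n) := by
    rw [Fintype.card_fin]
    have h1 := h.card_eq
    have h2 : (0 : ℝ) ≤ n := n.cast_nonneg
    have : (2 * S.card : ℝ) ≤ n := by nlinarith
    exact_mod_cast this
  have hS : (1 - ε) * S.card ≤ ∑ i ∈ S, ∑ j ∈ S, walkMatrix G i j := by
    have h1 := expansion_mul_card (G := G) S
    have h2 := mul_le_mul_of_nonneg_right h.nonexpanding (Nat.cast_nonneg (α := ℝ) S.card)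
    linarith
  have hexp : ∀ R : Finset (Fin n), R.card = S.card → Disjoint R S →
      ∑ i ∈ R, ∑ j ∈ R, walkMatrix G i j ≤ ε * S.card := fun R hRc hR => by
    have h1 := expansion_mul_card (G := G) R
    have h2 := mul_le_mul_of_nonneg_right
      (h.expanding R (by rw [hRc, h.card_eq]) hR) (Nat.cast_nonneg (α := ℝ) R.card)
    rw [← hRc]
    linarith
  obtain h0 | h1 | htwo : S.card = 0 ∨ S.card = 1 ∨ 2 ≤ S.card := by omega
  · have : T = ∅ := card_eq_zero.1 (by omega)
    have hz : euclideanIndicator T = 0 := by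
      ext i
      simp [euclideanIndicator, indicatorVec, this]
    rw [hz, map_zero, norm_zero]
    positivity
  -- A single vertex has no loop, so it expands fully, against `ε < 1`.
  · obtain ⟨v, rfl⟩ := card_eq_one.1 h1
    simp only [card_singleton, Nat.cast_one, sum_singleton, walkMatrix_self] at hS
    linarith
  have key : ∀ R ⊆ T, R.card + S.card / 2 ≤ S.card →
      ‖(topEigenspace G).starProjection (euclideanIndicator R)‖ ≤
        Real.sqrt (24 * ε * S.card) := fun R hR hRc => by
    refine Real.le_sqrt_of_sq_le ?_
    have h1 := norm_starProjection_euclideanIndicator_sq_le hG R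
    have h2 := sum_sq_walk_le hε walkMatrix_nonneg (sum_walkMatrix_row hd hG)
      (sum_walkMatrix_col hd hG) hcard hS hexp htwo (hT.mono_left hR) hRc
    linarith
  -- Rounding up makes both `R` and `T \ R` small enough for `key`.
  obtain ⟨R, hR, hRc⟩ := exists_subset_card_eq (min_le_left T.card (S.card - S.card / 2))
  have hdiff := card_sdiff_of_subset hR
  rw [euclideanIndicator_eq_add hR, map_add, two_mul]
  exact (norm_add_le _ _).trans
    (add_le_add (key R hR (by omega)) (key _ sdiff_subset (by omega)))

lemma five_mul_sqrt_le_rpow {ε : ℝ} (hε : 0 ≤ ε) (hε1 : ε ≤ 1 / 10 ^ 4) :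
    5 * Real.sqrt ε ≤ ε ^ (0.05 : ℝ) := by
  have h1 : Real.sqrt ε = ε ^ (0.05 : ℝ) * ε ^ (0.45 : ℝ) := by
    rw [Real.sqrt_eq_rpow, ← Real.rpow_add_of_nonneg hε (by norm_num) (by norm_num)]
    norm_num
  have h2 : ε ^ (0.45 : ℝ) ≤ 1 / 10 := by
    calc ε ^ (0.45 : ℝ) ≤ ((1 / 10 : ℝ) ^ (4 : ℝ)) ^ (0.45 : ℝ) :=
          Real.rpow_le_rpow hε (hε1.trans (by norm_num)) (by norm_num)
      _ = (1 / 10 : ℝ) ^ (1.8 : ℝ) := by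
          rw [← Real.rpow_mul (by norm_num)]
          norm_num
      _ ≤ (1 / 10 : ℝ) ^ (1 : ℝ) :=
          Real.rpow_le_rpow_of_exponent_ge (by norm_num) (by norm_num) (by norm_num)
      _ = 1 / 10 := Real.rpow_one _
  rw [h1]
  nlinarith [Real.rpow_nonneg hε (0.05 : ℝ)]

end SmallSetExpansion

theorem mainTheorem7 :
    ∃ ε₀ : ℝ, 0 < ε₀ ∧
      ∀ (n d : ℕ) (G : SimpleGraph (Fin n)) [DecidableRel G.Adj],
        0 < d → G.IsRegularOfDegree d →
      ∀ ε δ : ℝ, 0 ≤ ε → ε < ε₀ → 0 < δ → δ ≤ 1 / 2 →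
      ∀ S : Finset (Fin n), SmallSetExpansion.IsAlmostSSEWith G ε δ S →
      ∀ (m : ℕ) (b : Fin n → EuclideanSpace ℝ (Fin m)),
        SmallSetExpansion.IsIsotropicSpectralEmbedding G b →
      ∀ T : Finset (Fin n), (T.card : ℝ) ≤ δ * n → Disjoint T S →
        ‖(1 / (T.card : ℝ)) • ∑ i ∈ T, b i‖ * ((T.card : ℝ) / n)
          ≤ 2 * ε ^ (0.05 : ℝ) * Real.sqrt δ := by
  refine ⟨1 / 10 ^ 4, by norm_num, ?_⟩
  intro n d G _ hd hG ε δ hε hε1 hδ hδ2 S hS m b hb T hTc hT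
  rcases T.eq_empty_or_nonempty with rfl | hne
  · simp only [Finset.sum_empty, smul_zero, norm_zero, zero_mul]
    positivity
  have hT0 : (0 : ℝ) < T.card := Nat.cast_pos.2 hne.card_pos
  have hn : (0 : ℝ) < n := by
    by_contra! h
    nlinarith
  have hproj := hS.norm_starProjection_le hd hG hε (hε1.trans (by norm_num)) hδ2
    (by rw [← hS.card_eq] at hTc; exact_mod_cast hTc) hT
  have hlhs : ‖(1 / (T.card : ℝ)) • ∑ i ∈ T, b i‖ * ((T.card : ℝ) / n) =
      ‖∑ i ∈ T, b i‖ / n := by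
    rw [norm_smul, Real.norm_eq_abs, abs_of_pos (by positivity)]
    field_simp
  have hsum : ‖∑ i ∈ T, b i‖ ^ 2 ≤ n * (96 * ε * (δ * n)) := by
    rw [hb.norm_sum_sq, ← hS.card_eq]
    refine mul_le_mul_of_nonneg_left ?_ hn.le
    refine (pow_le_pow_left₀ (norm_nonneg _) hproj 2).trans_eq ?_
    rw [mul_pow, Real.sq_sqrt (by positivity)]
    ring
  rw [hlhs, div_le_iff₀ hn]
  refine le_trans ?_ (mul_le_mul_of_nonneg_right (mul_le_mul_of_nonneg_right
    (mul_le_mul_of_nonneg_left (SmallSetExpansion.five_mul_sqrt_le_rpow hε hε1.le) zero_le_two)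
    (Real.sqrt_nonneg δ)) hn.le)
  -- After squaring, the constants compare as `96 ≤ (2 * 5) ^ 2`.
  refine le_of_sq_le_sq (hsum.trans ?_) (by positivity)
  rw [mul_pow, mul_pow, mul_pow, mul_pow, Real.sq_sqrt hε, Real.sq_sqrt hδ.le]
  have : 0 ≤ ε * δ * (n : ℝ) ^ 2 := by positivity
  linarith
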